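/- Let $G=(V,E)$ be a finite connected simple graph and $K$ a field of characteristic $0$. Fix a numbering $C_1,\dots,C_N$ of the odd cycles of $G$ and let $n_i$ be the number of vertices of $C_i$. Call $(C_i,C_j)$ exceptional if every path of $G$ from a vertex of $C_i$ to a vertex of $C_j$ has length at least two. Let $\Theta$ be the set of symbols $\theta_{ij}$, one for each exceptional pair $(C_i,C_j)$ with $i<j$, and let $F=E\sqcup\Theta$. Let $\psi^*: K[F]\to K[V]$ be the homomorphism of polynomial $K$-algebras, in the variables $F$ and $V$ respectively, that sends an edge $uv\in E$ to $uv$ and $\theta_{ij}$ to $\prod_{v\in C_i}v\cdot\prod_{v\in C_j}v$. The hyperedge ring is $K[\hat G]=\psi^*(K[F])\subseteq K[V]$. The $\psi^*$-degree of a monomial $T\in K[F]$ is half the total degree of the monomial $\psi^*(T)$; for $m\ge 0$ let $K[\hat G]_m$ be the $K$-span of the $\psi^*(T)$ with $T$ a monomial of $\psi^*$-degree $m$. Let $\mathcal P_G\subset\mathbb R^V$ be the edge polytope, the convex hull of the vectors $\mathbf e_u+\mathbf e_v$ with $uv\in E$. Let $i_G(m)=|m\mathcal P_G\cap\mathbb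 Z^V|$ for $m\ge1$ and $i_G(0)=1$, and let $H_G(t)=\sum_{m\ge0}i_G(m)t^m$ be the Ehrhart series. The Ehrhart ring of $\mathcal P_G$ is the $K$-subalgebra of $K[x_v^{\pm1}\,(v\in V),\,t]$ generated by the monomials $x^at^m$ with $m\ge1$ and $a\in m\mathcal P_G\cap\mathbb Z^V$, graded by the exponent of $t$. Then every edge has $\psi^*$-degree $1$ and every $\theta_{ij}\in\Theta$ has $\psi^*$-degree $(n_i+n_j)/2$. The subspaces $K[\hat G]_m$ $(m\ge0)$ are finite-dimensional and make $K[\hat G]=\bigoplus_{m\ge0}K[\hat G]_m$ a graded $K$-algebra, whose Hilbert series is the Ehrhart series: $$\sum_{m\ge0}\bigl(\dim_K K[\hat G]_m\bigr)t^m=H_G(t).$$ Moreover, $K[\hat G]$ is isomorphic, as a graded $K$-algebra, to the Ehrhart ring of $\mathcal P_G$. All this holds whether or not $G$ satisfies the odd cycle condition (that any two odd cycles of $G$ share a vertex or are joined by an edge). -/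

import Mathlib

noncomputable section

open scoped Pointwise

namespace HyperedgeRing

variable {V : Type*}

/-- The odd cycles of a simple graph, as subgraphs. -/
abbrev OddCycle (G : SimpleGraph V) : Type _ :=
  {H : G.Subgraph // ∃ (u : V) (p : G.Walk u u), p.IsCycle ∧ Odd p.length ∧ p.toSubgraph = H}

/-- A pair of cycles is exceptional if every path connecting a vertex of the first to a vertex
of the second has length at least two (in particular the cycles are disjoint). -/
def IsExceptional (G : SimpleGraph V) (C D : OddCycle G) : Prop :=
  ∀ u ∈ C.1.verts, ∀ v ∈ D.1.verts, ∀ p : G.Walk u v, p.IsPath → 2 ≤ p.length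

/-- The set `Θ` of symbols `θ_ij`, one for each exceptional pair `(C_i, C_j)` with `i < j`,
for a numbering `C` of the odd cycles. -/
abbrev Theta {G : SimpleGraph V} {N : ℕ} (C : Fin N ≃ OddCycle G) : Type :=
  {p : Fin N × Fin N // p.1 < p.2 ∧ IsExceptional G (C p.1) (C p.2)}

/-- The set `F = E ∪ Θ` of hyperedges (a disjoint union). -/
abbrev Hyperedge {G : SimpleGraph V} {N : ℕ} (C : Fin N ≃ OddCycle G) : Type _ :=
  G.edgeSet ⊕ Theta C

section Ring

variable (K : Type*) [Field K] [Fintype V] {G : SimpleGraph V} {N : ℕ} (C : Fin N ≃ OddCycle G)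

open Classical in
/-- The map `ψ`: an edge goes to the product of its two end points, and `θ_ij` to the product of
the vertices of `C_i` and of `C_j`. The ring of the free commutative monoid on `V` is
`MvPolynomial V K`. -/
def psi : Hyperedge C → MvPolynomial V K
  | Sum.inl e => ∏ v with v ∈ e.1, MvPolynomial.X v
  | Sum.inr p => (∏ v with v ∈ (C p.1.1).1.verts, MvPolynomial.X v) *
      ∏ v with v ∈ (C p.1.2).1.verts, MvPolynomial.X v

/-- The `K`-algebra homomorphism `ψ*` extending `ψ`. -/
def psiStar : MvPolynomial (Hyperedge C) K →ₐ[K] MvPolynomial V K :=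
  MvPolynomial.aeval (psi K C)

/-- The hyperedge ring: the image of `ψ*`. -/
def hyperedgeRing : Subalgebra K (MvPolynomial V K) := (psiStar K C).range

/-- The `ψ*`-degree of the monomial with exponents `T`: half the number of vertices, counted with
multiplicity, in the monomial `ψ*(T)`. -/
def psiDegree (T : Hyperedge C →₀ ℕ) : ℚ :=
  ((psiStar K C (MvPolynomial.monomial T 1)).totalDegree : ℚ) / 2

/-- The degree `m` piece of the hyperedge ring: the `K`-span of the images of the monomials
of `ψ*`-degree `m`. -/
def hyperedgePiece (m : ℕ) : Submodule K (hyperedgeRing K C) :=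
  (Submodule.span K {f : MvPolynomial V K | ∃ T : Hyperedge C →₀ ℕ, psiDegree K C T = m ∧
    f = psiStar K C (MvPolynomial.monomial T 1)}).comap (hyperedgeRing K C).val.toLinearMap

end Ring

/-- The Hilbert series of a family `A` of subspaces: the coefficient of `t ^ n` is `dim_K A_n`. -/
def hilbertSeries {K R : Type*} [Field K] [Ring R] [Algebra K R] (A : ℕ → Submodule K R) :
    PowerSeries ℤ :=
  PowerSeries.mk fun n => (Module.finrank K (A n) : ℤ)

section Ehrhart

open Classical in
/-- The edge polytope: the convex hull in `ℝ^V` of the vectors `e_u + e_v` over the edges `uv`. -/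
def edgePolytope (G : SimpleGraph V) : Set (V → ℝ) :=
  convexHull ℝ (Set.range fun e : G.edgeSet => fun v : V => if v ∈ e.1 then (1 : ℝ) else 0)

/-- The integral points of the dilation `mP`. For `m = 0` this is the origin alone, which for
nonempty `P` is the general formula and for empty `P` is the convention that the value at `0` of
the counting function is `1`. -/
def latticePoints (P : Set (V → ℝ)) (m : ℕ) : Set (V → ℤ) :=
  if m = 0 then {0} else {z | (fun v => (z v : ℝ)) ∈ (m : ℝ) • P}

/-- The Ehrhart series: the coefficient of `t ^ m` is the number of integral points of `mP`. -/
def ehrhartSeries (P : Set (V → ℝ)) : PowerSeries ℤ :=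
  PowerSeries.mk fun m => ((latticePoints P m).ncard : ℤ)

variable (K : Type*) [Field K]

/-- The Ehrhart ring of a polytope: the subalgebra of `K[x_v^{±1} (v ∈ V), t]` generated by the
monomials `x^a t^m` where `a` is an integral point of `mP`. (As `P` is convex, these monomials are
closed under multiplication, so they are a `K`-basis.) -/
def ehrhartRing (P : Set (V → ℝ)) : Subalgebra K (AddMonoidAlgebra K ((V → ℤ) × ℕ)) :=
  Algebra.adjoin K {f | ∃ (m : ℕ) (a : V → ℤ), a ∈ latticePoints P m ∧
    f = AddMonoidAlgebra.single (a, m) 1}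

/-- The degree `m` piece of the Ehrhart ring: the span of its monomials `x^a t^m`. -/
def ehrhartPiece (P : Set (V → ℝ)) (m : ℕ) : Submodule K (ehrhartRing K P) :=
  (Submodule.span K {f : AddMonoidAlgebra K ((V → ℤ) × ℕ) | ∃ a ∈ latticePoints P m,
    f = AddMonoidAlgebra.single (a, m) 1}).comap (ehrhartRing K P).val.toLinearMap

end Ehrhart

end HyperedgeRing

end

noncomputable section

open scoped Pointwise

namespace HyperedgeRing

variable {V : Type*}

/-! ### Monomial exponents as sums of edges, odd cycles and closed walks. -/

section EdgeMonoid

open SimpleGraph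

/-! Both rings are monoid algebras, so everything reduces to `mem_hyperedgeMonoid_iff`: the
exponents of the hyperedge ring are exactly the vectors of natural numbers of even degree in the
cone over the edge polytope. Points of `mP` are the cone points with coordinate sum `2m`, which
matches the grading.

An odd cycle is half the sum of its edges, so all generators lie in the cone. Conversely, take `a`
in the cone and replace each vertex `v` by `a v` copies. The cone inequalities `edgeCone_sum_le` are
Hall's condition, giving a permutation of the copies that moves each one to a neighbour
(`mem_cycleMonoid_of_mem_edgeCone`). Its cycles are closed walks, which loop erasure cuts into edges
and odd cycles (`exists_path_add_mem`). Two odd cycles together always lie in the monoid: through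
some `θ` if they are exceptional, through edges alone otherwise (`cycle_add_cycle_mem`). So at most
one odd cycle is left over, and even degree excludes it. -/

/-- The exponent vector of the product of the entries of a list of vertices. -/
def listVec (l : List V) : V →₀ ℕ := (l.map fun v => Finsupp.single v 1).sum

@[simp] lemma listVec_nil : listVec ([] : List V) = 0 := rfl

@[simp] lemma listVec_cons (v : V) (l : List V) :
    listVec (v :: l) = Finsupp.single v 1 + listVec l := by simp [listVec]

@[simp] lemma listVec_append (l l' : List V) :
    listVec (l ++ l') = listVec l + listVec l' := by simp [listVec]

lemma listVec_perm {l l' : List V} (h : l.Perm l') : listVec l = listVec l' :=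
  (h.map _).sum_eq

@[simp] lemma degree_listVec (l : List V) : (listVec l).degree = l.length := by
  induction l with
  | nil => simp
  | cons v l ih => simp [ih, add_comm]

variable {G : SimpleGraph V}

lemma OddCycle.verts_nonempty (D : OddCycle G) : D.1.verts.Nonempty := by
  obtain ⟨H, w, p, hp, hodd, rfl⟩ := D
  exact ⟨w, by simp⟩

lemma IsExceptional.symm {D D' : OddCycle G} (h : IsExceptional G D D') :
    IsExceptional G D' D := fun u hu v hv p hp => by
  simpa using h v hv u hu p.reverse hp.reverse

/-- The starting vertex is dropped so that one full turn around a cycle of `σ` counts each point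
once. -/
lemma exists_walk_iterate {X : Type*} (f : X → V) (σ : X → X)
    (x : X) (h : ∀ n, G.Adj (f (σ^[n] x)) (f (σ^[n + 1] x))) (n : ℕ) :
    ∃ p : G.Walk (f x) (f (σ^[n] x)),
      listVec p.support.tail = ∑ i ∈ Finset.range n, Finsupp.single (f (σ^[i + 1] x)) 1 := by
  induction n with
  | zero => exact ⟨.nil, by simp⟩
  | succ n ih =>
    obtain ⟨p, hp⟩ := ih
    refine ⟨p.concat (h n), ?_⟩
    rw [Walk.support_concat, List.tail_append_of_ne_nil (by simp),
      listVec_append, hp, Finset.sum_range_succ]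
    simp

open Classical in
/-- The exponent vector of the product of the vertices in a set. -/
def setVec [Fintype V] (s : Set V) : V →₀ ℕ := ∑ v with v ∈ s, Finsupp.single v 1

variable [Fintype V]

lemma setVec_apply (s : Set V) (v : V) [Decidable (v ∈ s)] :
    setVec s v = if v ∈ s then 1 else 0 := by
  classical
  simp [setVec, Finsupp.finsetSum_apply, Finsupp.single_apply]

lemma setVec_eq_listVec {s : Set V} {l : List V} (hl : l.Nodup) (h : ∀ v, v ∈ l ↔ v ∈ s) :
    setVec s = listVec l := by
  classical
  rw [setVec, listVec, ← List.sum_toFinset _ hl]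
  exact Finset.sum_congr (by ext v; simp [h]) fun _ _ => rfl

lemma degree_setVec (s : Set V) : (setVec s).degree = s.ncard := by
  classical
  rw [setVec, map_sum]
  simp [Set.ncard_eq_toFinset_card']

lemma setVec_edge {u v : V} (h : G.Adj u v) :
    setVec {w | w ∈ s(u, v)} = Finsupp.single u 1 + Finsupp.single v 1 := by
  rw [setVec_eq_listVec (l := [u, v]) (by simpa using h.ne) (by simp)]
  simp

section Monoid

variable {N : ℕ} (C : Fin N ≃ OddCycle G)

/-- The exponent vector of the monomial `ψ h`. -/
def hyperedgeVec : Hyperedge C → V →₀ ℕ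
  | Sum.inl e => setVec {v | v ∈ e.1}
  | Sum.inr p => setVec (C p.1.1).1.verts + setVec (C p.1.2).1.verts

/-- The exponent vector of `ψ* T`, as a homomorphism in the exponent vector of `T`. -/
def expHom : (Hyperedge C →₀ ℕ) →+ (V →₀ ℕ) :=
  Finsupp.liftAddHom fun h => (multiplesHom _) (hyperedgeVec C h)

@[simp] lemma expHom_single (h : Hyperedge C) (n : ℕ) :
    expHom C (Finsupp.single h n) = n • hyperedgeVec C h := by
  simp [expHom]

/-- The monoid of the exponents of the monomials in the hyperedge ring. -/
def hyperedgeMonoid : AddSubmonoid (V →₀ ℕ) := AddMonoidHom.mrange (expHom C)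

lemma hyperedgeVec_mem (h : Hyperedge C) : hyperedgeVec C h ∈ hyperedgeMonoid C :=
  ⟨Finsupp.single h 1, by simp⟩

lemma edge_mem {u v : V} (h : G.Adj u v) :
    Finsupp.single u 1 + Finsupp.single v 1 ∈ hyperedgeMonoid C := by
  rw [← setVec_edge h]
  exact hyperedgeVec_mem C (Sum.inl ⟨s(u, v), h⟩)

lemma hyperedgeMonoid_induction {P : (V →₀ ℕ) → Prop} (zero : P 0)
    (add : ∀ a b, P a → P b → P (a + b)) (gen : ∀ h, P (hyperedgeVec C h))
    {a : V →₀ ℕ} (ha : a ∈ hyperedgeMonoid C) : P a := by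
  obtain ⟨T, rfl⟩ := ha
  induction T using Finsupp.induction_linear with
  | zero => simpa using zero
  | add f g hf hg => rw [map_add]; exact add _ _ hf hg
  | single h n =>
    rw [expHom_single]
    induction n with
    | zero => simpa using zero
    | succ n ih => rw [succ_nsmul]; exact add _ _ ih (gen h)

/-- A walk of odd length has an even number of vertices, and consecutive ones pair off into edges.
-/
lemma listVec_support_mem_of_odd {u v : V} :
    ∀ p : G.Walk u v, Odd p.length → listVec p.support ∈ hyperedgeMonoid C
  | .nil, h => by simp at h
  | .cons h .nil, _ => by simpa using edge_mem C h
  | .cons h (.cons h' p), hp => by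
    have := listVec_support_mem_of_odd p (by
      simp only [Walk.length_cons] at hp; grind)
    simpa [add_assoc] using add_mem (edge_mem C h) this

end Monoid

/-- Rotation allows any vertex as base point, so that two cycles can be spliced where they meet. -/
lemma OddCycle.exists_walk (D : OddCycle G) {u : V} (hu : u ∈ D.1.verts) :
    ∃ p : G.Walk u u, Odd p.length ∧ setVec D.1.verts = listVec p.support.tail := by
  classical
  obtain ⟨H, w, p, hp, hodd, rfl⟩ := D
  have hu' : u ∈ p.support := by simpa using hu
  refine ⟨p.rotate u hu', by simpa using hodd, ?_⟩
  rw [listVec_perm (p.support_rotate u hu').perm]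
  refine setVec_eq_listVec hp.support_nodup fun v => ?_
  have : p.support = w :: p.support.tail := p.cons_tail_support.symm
  have hw : w ∈ p.support.tail := Walk.end_mem_tail_support hp.not_nil
  rw [Walk.mem_verts_toSubgraph]
  constructor
  · exact List.mem_of_mem_tail
  · rw [this]; intro h
    rcases List.mem_cons.1 h with rfl | h
    · exact hw
    · exact h

lemma OddCycle.odd_degree (D : OddCycle G) : Odd (setVec D.1.verts).degree := by
  obtain ⟨u, hu⟩ := D.verts_nonempty
  obtain ⟨p, hp, h⟩ := D.exists_walk hu
  rw [h, degree_listVec]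
  simpa using hp

variable {N : ℕ} (C : Fin N ≃ OddCycle G)

lemma cycle_add_cycle_mem (D D' : OddCycle G) :
    setVec D.1.verts + setVec D'.1.verts ∈ hyperedgeMonoid C := by
  by_cases hex : IsExceptional G D D'
  -- A cycle is not exceptional with itself, because of the path of length zero.
  · have hne : D ≠ D' := by
      rintro rfl
      obtain ⟨u, hu⟩ := D.verts_nonempty
      simpa using hex u hu u hu Walk.nil Walk.IsPath.nil
    obtain ⟨i, rfl⟩ := C.surjective D
    obtain ⟨j, rfl⟩ := C.surjective D'
    rcases lt_trichotomy i j with h | rfl | h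
    · exact hyperedgeVec_mem C (Sum.inr ⟨(i, j), h, hex⟩)
    · exact absurd rfl hne
    · rw [add_comm]
      exact hyperedgeVec_mem C (Sum.inr ⟨(j, i), h, hex.symm⟩)
  · simp only [IsExceptional, not_forall, not_le] at hex
    obtain ⟨u, hu, v, hv, r, -, hr⟩ := hex
    obtain ⟨p, hp, hD⟩ := D.exists_walk hu
    obtain ⟨q, hq, hD'⟩ := D'.exists_walk hv
    rw [hD, hD']
    cases p with
    | nil => simp at hp
    | cons hp₁ p =>
    cases r with
    | nil =>
      -- Common vertex: dropping the first edge of one closed walk and appending the other gives odd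
      -- length.
      have := listVec_support_mem_of_odd C (p.append q) (by
        simp only [Walk.length_cons, Walk.length_append] at *; grind)
      simpa [Walk.support_append] using this
    | cons h r =>
    cases r with
    | nil =>
      have hq' : listVec q.support.tail = listVec q.reverse.support.tail := by
        have h₁ : q.support.Perm q.reverse.support := by simp
        rw [← q.cons_tail_support, ← q.reverse.cons_tail_support] at h₁
        exact listVec_perm (List.Perm.cons_inv h₁)
      rw [hq']
      have hqr : Odd q.reverse.length := by simpa using hq
      generalize q.reverse = q at hqr
      cases q with
      | nil => simp at hqr
      | cons hq₁ q =>
      -- Joining edge: both closed walks lose an edge at the contact vertex, and `h` links the two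
      -- even walks into an odd one.
      have := listVec_support_mem_of_odd C (p.append (.cons h q.reverse)) (by
        simp only [Walk.length_cons, Walk.length_append, Walk.length_reverse] at *; grind)
      simpa [Walk.support_append, listVec_perm (List.reverse_perm _)] using this
    | cons h' r => simp only [Walk.length_cons] at hr; omega

/-- The sums of an element of the hyperedge monoid and at most one odd cycle. -/
def cycleMonoid : AddSubmonoid (V →₀ ℕ) where
  carrier := {a | a ∈ hyperedgeMonoid C ∨
    ∃ D : OddCycle G, ∃ m ∈ hyperedgeMonoid C, a = m + setVec D.1.verts}
  zero_mem' := Or.inl (zero_mem _)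
  add_mem' := by
    rintro a b (ha | ⟨D, m, hm, rfl⟩) (hb | ⟨D', m', hm', rfl⟩)
    · exact Or.inl (add_mem ha hb)
    · exact Or.inr ⟨D', a + m', add_mem ha hm', by rw [add_assoc]⟩
    · exact Or.inr ⟨D, m + b, add_mem hm hb, by rw [add_right_comm]⟩
    · refine Or.inl ?_
      rw [add_add_add_comm]
      exact add_mem (add_mem hm hm') (cycle_add_cycle_mem C D D')

lemma degree_hyperedgeVec_edge (e : G.edgeSet) : (hyperedgeVec C (Sum.inl e)).degree = 2 := by
  obtain ⟨e, he⟩ := e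
  induction e using Sym2.ind with
  | _ u v =>
    simp only [hyperedgeVec]
    rw [setVec_edge he]
    simp

lemma even_degree_of_mem {a : V →₀ ℕ} (ha : a ∈ hyperedgeMonoid C) : Even a.degree := by
  refine hyperedgeMonoid_induction C (P := fun a => Even a.degree) (by simp)
    (fun a b ha hb => by simpa using ha.add hb) ?_ ha
  rintro (e | p)
  · simp [degree_hyperedgeVec_edge]
  · simpa [hyperedgeVec] using (C p.1.1).odd_degree.add_odd (C p.1.2).odd_degree

lemma mem_hyperedgeMonoid_of_even {a : V →₀ ℕ} (ha : a ∈ cycleMonoid C) (h : Even a.degree) :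
    a ∈ hyperedgeMonoid C := by
  rcases ha with ha | ⟨D, m, hm, rfl⟩
  · exact ha
  · have h₁ := even_degree_of_mem C hm
    have h₂ := D.odd_degree
    rw [map_add] at h
    grind

/-- This is the loop cut off in loop erasure: an even path closes up to an odd cycle, while the
vertices of an odd path pair off into edges. -/
lemma listVec_cons_path_mem {u v : V} (h : G.Adj u v) (p : G.Walk v u) (hp : p.IsPath) :
    listVec p.support ∈ cycleMonoid C := by
  rcases Nat.even_or_odd p.length with he | ho
  · have hc : (Walk.cons h p).IsCycle := by
      rw [Walk.cons_isCycle_iff]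
      -- If the closing edge already lay on `p`, then `p` would be that edge, of odd length.
      refine ⟨hp, fun hmem => ?_⟩
      rw [Sym2.eq_swap] at hmem
      rw [hp.length_eq_one_of_mem_edges hmem] at he
      simp at he
    refine Or.inr ⟨⟨(Walk.cons h p).toSubgraph, u, _, hc, by simpa using he.add_one, rfl⟩, 0,
      zero_mem _, ?_⟩
    rw [zero_add]
    refine (setVec_eq_listVec hp.support_nodup fun w => ?_).symm
    rw [Walk.mem_verts_toSubgraph, Walk.support_cons, List.mem_cons]
    constructor
    · exact Or.inr
    · rintro (rfl | h)
      · exact p.end_mem_support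
      · exact h
  · exact Or.inl (listVec_support_mem_of_odd C p ho)

/-- Loop erasure: whenever the new first vertex already lies on the path, the loop formed is split
off into the monoid. -/
lemma exists_path_add_mem {u v : V} (p : G.Walk u v) :
    ∃ q : G.Walk u v, q.IsPath ∧ ∃ m ∈ cycleMonoid C,
      listVec p.support.tail = listVec q.support.tail + m := by
  classical
  induction p with
  | nil => exact ⟨.nil, Walk.IsPath.nil, 0, zero_mem _, by simp⟩
  | @cons u v w h p ih =>
    obtain ⟨q, hq, m, hm, hpq⟩ := ih
    have hsum : listVec (Walk.cons h p).support.tail = listVec q.support + m := by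
      rw [Walk.support_cons, List.tail_cons, ← p.cons_tail_support, listVec_cons, hpq,
        ← q.cons_tail_support, listVec_cons, List.tail_cons, add_assoc]
    by_cases hu : u ∈ q.support
    · refine ⟨q.dropUntil u hu, hq.dropUntil hu, listVec (q.takeUntil u hu).support + m,
        add_mem (listVec_cons_path_mem C h _ (hq.takeUntil hu)) hm, ?_⟩
      rw [hsum]
      conv_lhs => rw [← q.take_spec hu, Walk.support_append, listVec_append]
      abel
    · exact ⟨.cons h q, hq.cons hu, m, hm, by simpa using hsum⟩

/-- A path from `u` to itself is trivial, so loop erasure leaves only the erased loops. -/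
lemma listVec_closed_mem {u : V} (p : G.Walk u u) : listVec p.support.tail ∈ cycleMonoid C := by
  obtain ⟨q, hq, m, hm, h⟩ := exists_path_add_mem C p
  rw [(Walk.isPath_iff_nil.1 hq).eq_nil] at h
  simpa [h] using hm

lemma sum_perm_mem {X : Type*} [Fintype X] [DecidableEq X] (f : X → V) (σ : Equiv.Perm X)
    (h : ∀ x ∈ σ.support, G.Adj (f x) (f (σ x))) :
    ∑ x ∈ σ.support, Finsupp.single (f x) 1 ∈ cycleMonoid C := by
  induction σ using Equiv.Perm.cycle_induction_on with
  | base_one => simp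
  | base_cycles σ hσ =>
    obtain ⟨x, hx, -⟩ := id hσ
    have hmem : ∀ n, σ^[n] x ∈ σ.support := fun n => by
      rw [← Equiv.Perm.coe_pow, Equiv.Perm.pow_apply_mem_support]
      simpa using hx
    obtain ⟨p, hp⟩ := exists_walk_iterate (G := G) f σ x (fun n => by
      rw [Function.iterate_succ_apply']; exact h _ (hmem n)) (orderOf σ)
    have hfix : σ^[orderOf σ] x = x := by
      rw [← Equiv.Perm.coe_pow, pow_orderOf_eq_one]; rfl
    have key : ∑ x ∈ σ.support, Finsupp.single (f x) 1 =
        ∑ i ∈ Finset.range (orderOf σ), Finsupp.single (f (σ^[i + 1] x)) 1 := by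
      symm
      refine Finset.sum_bij (fun i _ => σ^[i + 1] x) (fun i _ => hmem _) ?_ ?_ fun _ _ => rfl
      · intro i hi j hj hij
        simp only [Function.iterate_succ_apply', EmbeddingLike.apply_eq_iff_eq,
          ← Equiv.Perm.coe_pow] at hij
        rw [Finset.mem_range] at hi hj
        exact pow_injOn_Iio_orderOf hi hj
          ((hσ.pow_eq_pow_iff).2 ⟨x, hx, hij⟩)
      · intro y hy
        obtain ⟨z, rfl⟩ := σ.surjective y
        have hz : σ z ≠ z := by simpa using hy
        obtain ⟨i, hi, hiz⟩ := (hσ.sameCycle hx hz).exists_pow_eq'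
        refine ⟨i, Finset.mem_range.2 hi, ?_⟩
        rw [Function.iterate_succ_apply', ← Equiv.Perm.coe_pow, hiz]
    rw [key, ← hp]
    -- Rewriting the endpoint in the type of `p` makes it a closed walk.
    revert p
    rw [hfix]
    exact fun p _ => listVec_closed_mem C p
  | induction_disjoint σ τ hd _ hσ hτ =>
    rw [hd.support_mul, Finset.sum_union hd.disjoint_support]
    refine add_mem (hσ fun x hx => ?_) (hτ fun x hx => ?_)
    · have := h x (by rw [hd.support_mul]; exact Finset.mem_union_left _ hx)
      rwa [Equiv.Perm.mul_apply,
        Equiv.Perm.notMem_support.1 (Finset.disjoint_left.1 hd.disjoint_support hx)] at this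
    · have := h x (by rw [hd.support_mul]; exact Finset.mem_union_right _ hx)
      rwa [Equiv.Perm.mul_apply, Equiv.Perm.notMem_support.1
        (Finset.disjoint_right.1 hd.disjoint_support (Equiv.Perm.apply_mem_support.2 hx))] at this

end EdgeMonoid

/-! ### The cone over the edge polytope and its lattice points. -/

section Cone

open scoped NNReal

open Classical in
/-- The indicator function of an edge. -/
def edgeIndicator {G : SimpleGraph V} (e : G.edgeSet) (v : V) : ℝ := if v ∈ e.1 then 1 else 0

/-- The cone over the edge polytope. -/
def edgeCone (G : SimpleGraph V) : Submodule ℝ≥0 (V → ℝ) :=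
  Submodule.span ℝ≥0 (Set.range (edgeIndicator (G := G)))

lemma edgePolytope_eq (G : SimpleGraph V) :
    edgePolytope G = convexHull ℝ (Set.range (edgeIndicator (G := G))) := rfl

/-- The real vector with the same entries as a vector of natural numbers. -/
def toReal : (V →₀ ℕ) →+ (V → ℝ) where
  toFun s v := s v
  map_zero' := by ext; simp
  map_add' a b := by ext; simp

@[simp] lemma toReal_apply (s : V →₀ ℕ) (v : V) : toReal s v = s v := rfl

/-- The integral vector with the same entries as a vector of natural numbers. -/
def toInt : (V →₀ ℕ) →+ (V → ℤ) where
  toFun s v := s v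
  map_zero' := by ext; simp
  map_add' a b := by ext; simp

lemma toInt_injective : Function.Injective (toInt (V := V)) := fun a b h => by
  ext v
  exact Nat.cast_injective (R := ℤ) (congrFun h v)

variable {G : SimpleGraph V}

lemma nonneg_of_mem_edgeCone {x : V → ℝ} (hx : x ∈ edgeCone G) : 0 ≤ x := by
  induction hx using Submodule.span_induction with
  | mem x hx =>
    obtain ⟨e, rfl⟩ := hx
    intro v
    simp only [edgeIndicator, Pi.zero_apply]
    positivity
  | zero => exact le_rfl
  | add x y _ _ hx hy => exact add_nonneg hx hy
  | smul r x _ hx => exact smul_nonneg r.2 hx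

variable [Fintype V]

lemma sum_toReal (s : V →₀ ℕ) : ∑ v, toReal s v = s.degree := by
  simp [Finsupp.degree_eq_sum]

lemma toReal_setVec_edge (e : G.edgeSet) : toReal (setVec {v | v ∈ e.1}) = edgeIndicator e := by
  classical
  ext v
  simp [setVec_apply, edgeIndicator]

lemma sum_edgeIndicator (e : G.edgeSet) : ∑ v, edgeIndicator e v = 2 := by
  rw [← toReal_setVec_edge, sum_toReal]
  obtain ⟨e, he⟩ := e
  induction e using Sym2.ind with
  | _ u v => rw [setVec_edge he]; norm_num

lemma adj_mem_edgeCone {u v : V} (h : G.Adj u v) :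
    toReal (Finsupp.single u 1 + Finsupp.single v 1) ∈ edgeCone G := by
  rw [← setVec_edge h, toReal_setVec_edge ⟨s(u, v), h⟩]
  exact Submodule.subset_span ⟨_, rfl⟩

/-- The vector is the sum of the edges of `p`: interior vertices count twice and the two ends once.
For a closed walk the correction terms cancel. -/
lemma walk_mem_edgeCone {u v : V} (p : G.Walk u v) :
    2 • toReal (listVec p.support.tail) + toReal (Finsupp.single u 1) -
      toReal (Finsupp.single v 1) ∈ edgeCone G := by
  induction p with
  | nil => simp
  | @cons u v w h p ih =>
    rw [SimpleGraph.Walk.support_cons, List.tail_cons, ← p.cons_tail_support, listVec_cons]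
    convert add_mem (adj_mem_edgeCone h) ih using 1
    simp only [map_add]
    abel

lemma setVec_oddCycle_mem_edgeCone (D : OddCycle G) :
    toReal (setVec D.1.verts) ∈ edgeCone G := by
  obtain ⟨u, hu⟩ := D.verts_nonempty
  obtain ⟨p, -, h⟩ := D.exists_walk hu
  have hp := walk_mem_edgeCone p
  rw [add_sub_cancel_right, ← h] at hp
  convert (edgeCone G).smul_mem (1 / 2 : ℝ≥0) hp using 1
  ext v
  simp [NNReal.smul_def]

variable {N : ℕ} (C : Fin N ≃ OddCycle G)

lemma toReal_mem_edgeCone {a : V →₀ ℕ} (ha : a ∈ hyperedgeMonoid C) :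
    toReal a ∈ edgeCone G := by
  refine hyperedgeMonoid_induction C (P := fun a => toReal a ∈ edgeCone G) (by simp)
    (fun a b ha hb => by simpa using add_mem ha hb) ?_ ha
  rintro (e | p)
  · rw [hyperedgeVec, toReal_setVec_edge]
    exact Submodule.subset_span ⟨_, rfl⟩
  · simpa [hyperedgeVec] using add_mem (setVec_oddCycle_mem_edgeCone (C p.1.1))
      (setVec_oddCycle_mem_edgeCone (C p.1.2))

/-- The inequality is linear, so edges suffice: each end in `S` makes the other end a neighbour of
`S`. -/
lemma edgeCone_sum_le [DecidableEq V] [DecidableRel G.Adj] {x : V → ℝ} (hx : x ∈ edgeCone G)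
    (S : Finset V) : ∑ v ∈ S, x v ≤ ∑ v with ∃ u ∈ S, G.Adj u v, x v := by
  induction hx using Submodule.span_induction with
  | mem x hx =>
    obtain ⟨⟨e, he⟩, rfl⟩ := hx
    induction e using Sym2.ind with
    | _ u v =>
      have hsum : ∀ T : Finset V, ∑ w ∈ T, edgeIndicator ⟨s(u, v), he⟩ w =
          (if u ∈ T then 1 else 0) + (if v ∈ T then 1 else 0) := fun T => by
        rw [← toReal_setVec_edge]
        simp only [setVec_edge he]
        simp [Finsupp.single_apply, Finset.sum_add_distrib]
      rw [hsum, hsum]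
      have h₁ : u ∈ S → ∃ w ∈ S, G.Adj w v := fun h => ⟨u, h, he⟩
      have h₂ : v ∈ S → ∃ w ∈ S, G.Adj w u := fun h => ⟨v, h, SimpleGraph.Adj.symm he⟩
      by_cases hu : u ∈ S <;> by_cases hv : v ∈ S <;> simp [hu, hv, h₁, h₂] <;> positivity
  | zero => simp
  | add x y _ _ hx hy => simpa [Finset.sum_add_distrib] using add_le_add hx hy
  | smul r x _ hx =>
    simp only [Pi.smul_apply, NNReal.smul_def, smul_eq_mul, ← Finset.mul_sum]
    exact mul_le_mul_of_nonneg_left hx r.2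

lemma mem_cycleMonoid_of_mem_edgeCone {a : V →₀ ℕ} (ha : toReal a ∈ edgeCone G) :
    a ∈ cycleMonoid C := by
  classical
  let X := Σ v, Fin (a v)
  let t : X → Finset X := fun x => Finset.univ.filter fun y => G.Adj x.1 y.1
  have hall : ∀ A : Finset X, A.card ≤ (A.biUnion t).card := fun A => by
    -- Adjacency ignores which copy is taken, so `A` may be enlarged to all copies of its vertices;
    -- Hall's condition then compares sums of entries of `a`.
    have h₁ : A ⊆ (A.image Sigma.fst).sigma fun _ => Finset.univ := fun x hx => by
      exact Finset.mem_sigma.2 ⟨Finset.mem_image_of_mem _ hx, Finset.mem_univ _⟩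
    have h₂ : (({v | ∃ u ∈ A.image Sigma.fst, G.Adj u v} : Finset V).sigma
        fun _ => Finset.univ) ⊆ A.biUnion t := fun y hy => by
      simp only [Finset.mem_sigma, Finset.mem_filter, Finset.mem_univ, true_and, and_true,
        Finset.mem_image] at hy
      obtain ⟨u, ⟨x, hx, rfl⟩, h⟩ := hy
      exact Finset.mem_biUnion.2 ⟨x, hx, by simpa [t] using h⟩
    refine (Finset.card_le_card h₁).trans (le_trans ?_ (Finset.card_le_card h₂))
    rw [Finset.card_sigma, Finset.card_sigma]
    have h₃ := edgeCone_sum_le ha (A.image Sigma.fst)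
    simp only [toReal_apply] at h₃
    simpa only [Finset.card_univ, Fintype.card_fin] using (by exact_mod_cast h₃)
  obtain ⟨g, hg, hgt⟩ := (Finset.all_card_le_biUnion_card_iff_exists_injective t).1 hall
  have hadj : ∀ x, G.Adj x.1 (g x).1 := fun x => by simpa [t] using hgt x
  let σ : Equiv.Perm X := Equiv.ofBijective g (Finite.injective_iff_bijective.1 hg)
  have hsupp : σ.support = Finset.univ := Finset.eq_univ_iff_forall.2 fun x => by
    rw [Equiv.Perm.mem_support]
    exact fun h => (hadj x).ne (congrArg Sigma.fst h).symm
  have := sum_perm_mem C Sigma.fst σ fun x _ => hadj x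
  rw [hsupp, Fintype.sum_sigma] at this
  convert this
  ext v
  simp

lemma mem_hyperedgeMonoid_iff {a : V →₀ ℕ} :
    a ∈ hyperedgeMonoid C ↔ toReal a ∈ edgeCone G ∧ Even a.degree :=
  ⟨fun h => ⟨toReal_mem_edgeCone C h, even_degree_of_mem C h⟩, fun h =>
    mem_hyperedgeMonoid_of_even C (mem_cycleMonoid_of_mem_edgeCone C h.1) h.2⟩

lemma edgePolytope_subset : edgePolytope G ⊆ {x | x ∈ edgeCone G ∧ ∑ v, x v = 2} := by
  rw [edgePolytope_eq]
  refine convexHull_min ?_ ?_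
  · rintro _ ⟨e, rfl⟩
    exact ⟨Submodule.subset_span ⟨e, rfl⟩, sum_edgeIndicator e⟩
  · rintro x ⟨hx, hx2⟩ y ⟨hy, hy2⟩ a b ha hb hab
    refine ⟨add_mem (Submodule.smul_mem _ ⟨a, ha⟩ hx) (Submodule.smul_mem _ ⟨b, hb⟩ hy), ?_⟩
    simp only [Pi.add_apply, Pi.smul_apply, smul_eq_mul, Finset.sum_add_distrib,
      ← Finset.mul_sum, hx2, hy2]
    linear_combination 2 * hab

/-- Each edge has coordinate sum 2, so coefficients of `x` over the edges sum to `m`; dividing by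
`m` yields convex weights. -/
lemma mem_smul_edgePolytope_iff {m : ℕ} (hm : m ≠ 0) (x : V → ℝ) :
    x ∈ (m : ℝ) • edgePolytope G ↔ x ∈ edgeCone G ∧ ∑ v, x v = 2 * m := by
  classical
  have hm' : (m : ℝ) ≠ 0 := Nat.cast_ne_zero.2 hm
  constructor
  · rintro ⟨y, hy, rfl⟩
    obtain ⟨hy, hy2⟩ := edgePolytope_subset hy
    refine ⟨Submodule.smul_mem _ (m : ℝ≥0) hy, ?_⟩
    simp only [Pi.smul_apply, smul_eq_mul, ← Finset.mul_sum, hy2]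
    ring
  · rintro ⟨hx, hx2⟩
    obtain ⟨c, rfl⟩ := (Submodule.mem_span_range_iff_exists_fun ℝ≥0).1 hx
    have hc : ∑ e, (c e : ℝ) = m := by
      simp only [Finset.sum_apply, Pi.smul_apply, NNReal.smul_def, smul_eq_mul] at hx2
      rw [Finset.sum_comm] at hx2
      simp only [← Finset.mul_sum, sum_edgeIndicator, ← Finset.sum_mul] at hx2
      linarith
    rw [Set.mem_smul_set_iff_inv_smul_mem₀ hm', Finset.smul_sum]
    have := (convex_convexHull ℝ (Set.range (edgeIndicator (G := G)))).sum_mem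
      (t := Finset.univ) (w := fun e => (m : ℝ)⁻¹ * c e) (z := edgeIndicator)
      (fun e _ => by positivity) (by rw [← Finset.mul_sum, hc, inv_mul_cancel₀ hm'])
      (fun e _ => subset_convexHull ℝ _ ⟨e, rfl⟩)
    simpa [edgePolytope_eq, mul_smul, NNReal.smul_def] using this

/-- The exponents of the monomials of degree `m` in the hyperedge ring. -/
def hyperedgeExponents (m : ℕ) : Set (V →₀ ℕ) := {a | a ∈ hyperedgeMonoid C ∧ a.degree = 2 * m}

lemma image_toInt_hyperedgeExponents (m : ℕ) :
    toInt '' hyperedgeExponents C m = latticePoints (edgePolytope G) m := by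
  have hR : ∀ a : V →₀ ℕ, (fun v => ((toInt a v : ℤ) : ℝ)) = toReal a := fun a => by
    ext v; simp [toInt]
  rcases eq_or_ne m 0 with rfl | hm
  -- Degree zero is separate: its only lattice point is the origin, by convention even for an empty
  -- polytope.
  · rw [latticePoints, if_pos rfl]
    refine Set.Subset.antisymm ?_ ?_
    · rintro _ ⟨a, ⟨-, ha⟩, rfl⟩
      have : a = 0 := (Finsupp.degree_eq_zero_iff a).1 (by simpa using ha)
      simp [this]
    · rintro _ rfl
      exact ⟨0, ⟨zero_mem _, by simp⟩, map_zero _⟩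
  · rw [latticePoints, if_neg hm]
    ext z
    rw [Set.mem_ofPred_eq, mem_smul_edgePolytope_iff hm]
    constructor
    · rintro ⟨a, ⟨ha, hd⟩, rfl⟩
      rw [hR, sum_toReal, hd]
      exact ⟨toReal_mem_edgeCone C ha, by push_cast; ring⟩
    · rintro ⟨hz, hsum⟩
      -- Cone points are nonnegative, so `toNat` loses nothing.
      have hpos : ∀ v, 0 ≤ z v := fun v =>
        Int.cast_nonneg_iff.1 (nonneg_of_mem_edgeCone hz v)
      let a : V →₀ ℕ := Finsupp.equivFunOnFinite.symm fun v => (z v).toNat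
      have haz : toInt a = z := by
        ext v; simpa [toInt, a] using hpos v
      rw [← haz] at hz hsum ⊢
      rw [hR] at hz hsum
      rw [sum_toReal] at hsum
      have hd : a.degree = 2 * m := by exact_mod_cast hsum
      exact ⟨a, ⟨(mem_hyperedgeMonoid_iff C).2 ⟨hz, by simp [hd]⟩, hd⟩, rfl⟩

lemma finite_hyperedgeExponents (m : ℕ) : (hyperedgeExponents C m).Finite := by
  refine (Finsupp.finite_of_degree_le (2 * m)).subset ?_
  rintro a ⟨-, ha⟩
  exact ha.le

end Cone

/-! ### Comparing subalgebras through injections into a common algebra. -/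

section Transfer

variable {K A B D : Type*} [Field K] [Ring A] [Algebra K A] [Ring B] [Algebra K B] [Ring D]
  [Algebra K D]

/-- Subalgebras with the same image under injective homomorphisms are isomorphic. -/
lemma exists_algEquiv_of_map_eq {S : Subalgebra K A} {T : Subalgebra K B} {f : A →ₐ[K] D}
    {g : B →ₐ[K] D} (hf : Function.Injective f) (hg : Function.Injective g)
    (h : S.map f = T.map g) : ∃ φ : S ≃ₐ[K] T, ∀ x, g (φ x) = f x := by
  refine ⟨((S.equivMapOfInjective f hf).trans (Subalgebra.equivOfEq _ _ h)).trans
    (T.equivMapOfInjective g hg).symm, fun x => ?_⟩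
  rw [← Subalgebra.coe_equivMapOfInjective_apply T g hg]
  simp

lemma map_comap_val_eq {S : Subalgebra K A} {T : Subalgebra K B} {f : A →ₐ[K] D}
    {g : B →ₐ[K] D} (hf : Function.Injective f) (hg : Function.Injective g)
    (φ : S ≃ₐ[K] T) (hφ : ∀ x, g (φ x) = f x) {P : Submodule K A} {Q : Submodule K B}
    (h : P.map f.toLinearMap = Q.map g.toLinearMap) :
    (P.comap S.val.toLinearMap).map φ.toLinearMap = Q.comap T.val.toLinearMap := by
  have key : ∀ x : S, (x : A) ∈ P ↔ ((φ x : T) : B) ∈ Q := fun x => by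
    have h₁ : (x : A) ∈ P ↔ f x ∈ P.map f.toLinearMap :=
      (hf.mem_set_image (s := (P : Set A))).symm
    have h₂ : ((φ x : T) : B) ∈ Q ↔ g (φ x) ∈ Q.map g.toLinearMap :=
      (hg.mem_set_image (s := (Q : Set B))).symm
    rw [h₁, h₂, hφ, h]
  ext y
  constructor
  · rintro ⟨x, hx, rfl⟩
    exact (key x).1 hx
  · intro hy
    obtain ⟨x, rfl⟩ := φ.surjective y
    exact ⟨x, (key x).2 hy, rfl⟩

end Transfer

/-! ### The grading of the hyperedge ring and its Hilbert series. -/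

section Grading

open MvPolynomial

variable (K : Type*) [Field K] [Fintype V] {G : SimpleGraph V} {N : ℕ} (C : Fin N ≃ OddCycle G)

lemma psi_eq_monomial (h : Hyperedge C) : psi K C h = monomial (hyperedgeVec C h) 1 := by
  rcases h with e | p
  · simp only [psi, hyperedgeVec, setVec, monomial_sum_one]
    exact Finset.prod_congr (by ext; simp) fun _ _ => rfl
  · simp only [psi, hyperedgeVec, setVec]
    rw [← one_mul (1 : K), ← monomial_mul, monomial_sum_one, monomial_sum_one]
    rfl

lemma psiStar_monomial (T : Hyperedge C →₀ ℕ) (c : K) :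
    psiStar K C (monomial T c) = monomial (expHom C T) c := by
  have h₁ : psiStar K C (monomial T 1) = monomial (expHom C T) 1 := by
    induction T using Finsupp.induction_linear with
    | zero => simp
    | add S T hS hT =>
      rw [← one_mul (1 : K), ← monomial_mul, map_mul, hS, hT, monomial_mul, map_add]
    | single h n =>
      rw [← X_pow_eq_monomial, map_pow, psiStar, aeval_X, psi_eq_monomial, monomial_pow,
        expHom_single, one_pow]
  have h₂ : ∀ (σ : Type _) (a : σ →₀ ℕ), monomial a c = c • monomial a (1 : K) := by
    simp [smul_monomial]
  rw [h₂, map_smul, h₁]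
  simp [smul_monomial]

lemma psiDegree_eq (T : Hyperedge C →₀ ℕ) :
    psiDegree K C T = ((expHom C T).degree : ℚ) / 2 := by
  rw [psiDegree, psiStar_monomial, totalDegree_monomial _ one_ne_zero]
  rfl

lemma psiDegree_eq_natCast_iff (T : Hyperedge C →₀ ℕ) (m : ℕ) :
    psiDegree K C T = m ↔ (expHom C T).degree = 2 * m := by
  rw [psiDegree_eq, div_eq_iff two_ne_zero, mul_comm]
  exact_mod_cast Iff.rfl

/-- The span of the monomials of degree `m` in the hyperedge ring. -/
def monomialSpan (m : ℕ) : Submodule K (MvPolynomial V K) :=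
  Submodule.span K ((fun a => monomial a 1) '' hyperedgeExponents C m)

lemma hyperedgePiece_eq (m : ℕ) : hyperedgePiece K C m =
    (monomialSpan K C m).comap (hyperedgeRing K C).val.toLinearMap := by
  rw [hyperedgePiece, monomialSpan]
  congr 2
  ext f
  constructor
  · rintro ⟨T, hT, rfl⟩
    exact ⟨expHom C T, ⟨⟨T, rfl⟩, (psiDegree_eq_natCast_iff K C T m).1 hT⟩,
      (psiStar_monomial K C T 1).symm⟩
  · rintro ⟨_, ⟨⟨T, rfl⟩, hT⟩, rfl⟩
    exact ⟨T, (psiDegree_eq_natCast_iff K C T m).2 hT, (psiStar_monomial K C T 1).symm⟩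

lemma monomial_mem_hyperedgeRing {a : V →₀ ℕ} (ha : a ∈ hyperedgeMonoid C) (c : K) :
    monomial a c ∈ hyperedgeRing K C := by
  obtain ⟨T, rfl⟩ := ha
  exact ⟨monomial T c, psiStar_monomial K C T c⟩

lemma monomialSpan_le (m : ℕ) :
    monomialSpan K C m ≤ Subalgebra.toSubmodule (hyperedgeRing K C) := by
  rw [monomialSpan, Submodule.span_le]
  rintro _ ⟨a, ha, rfl⟩
  exact monomial_mem_hyperedgeRing K C ha.1 1

lemma monomialSpan_le_homogeneousSubmodule (m : ℕ) :
    monomialSpan K C m ≤ homogeneousSubmodule V K (2 * m) := by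
  rw [monomialSpan, Submodule.span_le]
  rintro _ ⟨a, ha, rfl⟩
  exact isHomogeneous_monomial 1 ha.2

/-- Piece `m` sits in the homogeneous polynomials of degree `2 * m`, so independence is inherited
from the polynomial ring. -/
lemma iSupIndep_hyperedgePiece : iSupIndep (hyperedgePiece K C) := by
  let := gradedAlgebra (σ := V) (R := K)
  have hind : iSupIndep fun m : ℕ => homogeneousSubmodule V K (2 * m) :=
    (DirectSum.Decomposition.isInternal (homogeneousSubmodule V K)).submodule_iSupIndep.comp
      (mul_right_injective₀ two_ne_zero)
  have hle : ∀ m, (hyperedgePiece K C m).map (hyperedgeRing K C).val.toLinearMap ≤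
      homogeneousSubmodule V K (2 * m) := fun m => by
    rw [hyperedgePiece_eq, Submodule.map_le_iff_le_comap]
    exact Submodule.comap_mono (monomialSpan_le_homogeneousSubmodule K C m)
  intro m
  rw [Submodule.disjoint_def]
  intro x hx hx'
  have h₁ := hle m (Submodule.mem_map_of_mem hx)
  have h₂ := Submodule.mem_map_of_mem (f := (hyperedgeRing K C).val.toLinearMap) hx'
  simp only [Submodule.map_iSup] at h₂
  have h₃ := iSup₂_mono (fun j (_ : j ≠ m) => hle j) h₂
  exact Subtype.ext (Submodule.disjoint_def.1 (hind m) _ h₁ h₃)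

lemma iSup_hyperedgePiece : iSup (hyperedgePiece K C) = ⊤ := by
  rw [eq_top_iff]
  rintro ⟨_, p, rfl⟩ -
  induction p using MvPolynomial.induction_on' with
  | monomial T c =>
    obtain ⟨m, hm⟩ := even_degree_of_mem C ⟨T, rfl⟩
    refine Submodule.mem_iSup_of_mem m ?_
    rw [hyperedgePiece_eq, Submodule.mem_comap]
    change psiStar K C (monomial T c) ∈ monomialSpan K C m
    have h₁ : psiStar K C (monomial T c) = c • monomial (expHom C T) 1 := by
      simp [psiStar_monomial, smul_monomial]
    rw [h₁]
    exact Submodule.smul_mem _ _ (Submodule.subset_span ⟨_, ⟨⟨T, rfl⟩, by rw [hm, two_mul]⟩, rfl⟩)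
  | add p q hp hq =>
    have h := add_mem hp hq
    convert h using 1
    exact Subtype.ext (map_add _ _ _)

lemma one_mem_hyperedgePiece : 1 ∈ hyperedgePiece K C 0 := by
  rw [hyperedgePiece_eq]
  exact Submodule.subset_span ⟨0, ⟨zero_mem _, by simp⟩, rfl⟩

lemma mul_mem_hyperedgePiece {m n : ℕ} {x y : hyperedgeRing K C} (hx : x ∈ hyperedgePiece K C m)
    (hy : y ∈ hyperedgePiece K C n) : x * y ∈ hyperedgePiece K C (m + n) := by
  rw [hyperedgePiece_eq] at *
  have h := Submodule.mul_mem_mul (Submodule.mem_comap.1 hx) (Submodule.mem_comap.1 hy)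
  rw [monomialSpan, monomialSpan, Submodule.span_mul_span] at h
  refine Submodule.span_mono ?_ h
  rintro _ ⟨_, ⟨a, ha, rfl⟩, _, ⟨b, hb, rfl⟩, rfl⟩
  exact ⟨a + b, ⟨add_mem ha.1 hb.1, by rw [map_add, ha.2, hb.2, mul_add]⟩,
    by simp [monomial_mul]⟩

lemma nonempty_gradedAlgebra : Nonempty (GradedAlgebra (hyperedgePiece K C)) :=
  let : DirectSum.Decomposition (hyperedgePiece K C) :=
    (DirectSum.isInternal_submodule_of_iSupIndep_of_iSup_eq_top (iSupIndep_hyperedgePiece K C)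
      (iSup_hyperedgePiece K C)).chooseDecomposition
  ⟨{ one_mem := one_mem_hyperedgePiece K C
     mul_mem := fun _ _ _ _ => mul_mem_hyperedgePiece K C }⟩

/-- The pieces of the hyperedge ring, as subspaces of the polynomial ring. -/
def hyperedgePieceEquiv (m : ℕ) : hyperedgePiece K C m ≃ₗ[K] monomialSpan K C m :=
  (LinearEquiv.ofEq _ _ (hyperedgePiece_eq K C m)).trans
    (Submodule.comapSubtypeEquivOfLe (monomialSpan_le K C m))

lemma finiteDimensional_monomialSpan (m : ℕ) : FiniteDimensional K (monomialSpan K C m) :=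
  FiniteDimensional.span_of_finite K ((finite_hyperedgeExponents C m).image _)

lemma finiteDimensional_hyperedgePiece (m : ℕ) : FiniteDimensional K (hyperedgePiece K C m) :=
  have := finiteDimensional_monomialSpan K C m
  (hyperedgePieceEquiv K C m).symm.finiteDimensional

/-- Distinct monomials are linearly independent, so the dimension counts exponents. -/
lemma finrank_hyperedgePiece (m : ℕ) :
    Module.finrank K (hyperedgePiece K C m) = (hyperedgeExponents C m).ncard := by
  classical
  have hinj : Function.Injective fun a : V →₀ ℕ => monomial a (1 : K) :=
    monomial_left_injective one_ne_zero
  have := ((finite_hyperedgeExponents C m).image fun a => monomial a (1 : K)).fintype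
  have hli : LinearIndepOn K id ((fun a => monomial a (1 : K)) '' hyperedgeExponents C m) := by
    have h := (basisMonomials V K).linearIndependent
    rw [coe_basisMonomials] at h
    exact h.linearIndepOn_id.mono (Set.image_subset_range _ _)
  rw [(hyperedgePieceEquiv K C m).finrank_eq, monomialSpan, finrank_span_set_eq_card hli,
    ← Set.ncard_eq_toFinset_card', Set.ncard_image_of_injective _ hinj]

lemma hilbertSeries_hyperedgePiece : hilbertSeries (hyperedgePiece K C) =
    ehrhartSeries (edgePolytope G) := by
  ext m
  rw [hilbertSeries, ehrhartSeries, PowerSeries.coeff_mk, PowerSeries.coeff_mk,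
    finrank_hyperedgePiece, ← image_toInt_hyperedgeExponents C,
    Set.ncard_image_of_injective _ toInt_injective]

lemma hyperedgeRing_eq_adjoin : hyperedgeRing K C =
    Algebra.adjoin K ((fun a => monomial a 1) '' (hyperedgeMonoid C : Set (V →₀ ℕ))) := by
  refine le_antisymm ?_ (Algebra.adjoin_le ?_)
  · rw [hyperedgeRing, psiStar, ← Algebra.adjoin_range_eq_range_aeval]
    refine Algebra.adjoin_mono ?_
    rintro _ ⟨h, rfl⟩
    exact ⟨_, hyperedgeVec_mem C h, (psi_eq_monomial K C h).symm⟩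
  · rintro _ ⟨a, ha, rfl⟩
    exact monomial_mem_hyperedgeRing K C ha 1

end Grading

/-! ### The isomorphism with the Ehrhart ring. -/

section Comparison

open MvPolynomial

variable (K : Type*) [Field K]

/-- The embedding of the polynomial ring that records the degree in the variable `t`. -/
def polynomialEmbedding (V : Type*) :
    MvPolynomial V K →ₐ[K] AddMonoidAlgebra K ((V → ℤ) × ℕ) :=
  AddMonoidAlgebra.mapDomainAlgHom K K (toInt.prod Finsupp.degree)

/-- The endomorphism that doubles the exponent of `t`. -/
def doubleDegree (V : Type*) :
    AddMonoidAlgebra K ((V → ℤ) × ℕ) →ₐ[K] AddMonoidAlgebra K ((V → ℤ) × ℕ) :=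
  AddMonoidAlgebra.mapDomainAlgHom K K
    ((AddMonoidHom.id (V → ℤ)).prodMap (AddMonoidHom.mulLeft 2))

lemma polynomialEmbedding_monomial (a : V →₀ ℕ) :
    polynomialEmbedding K V (monomial a 1) = AddMonoidAlgebra.single (toInt a, a.degree) 1 :=
  AddMonoidAlgebra.mapDomain_single

lemma doubleDegree_single (a : V → ℤ) (m : ℕ) :
    doubleDegree K V (AddMonoidAlgebra.single (a, m) 1) =
      AddMonoidAlgebra.single (a, 2 * m) 1 :=
  AddMonoidAlgebra.mapDomain_single

lemma polynomialEmbedding_injective : Function.Injective (polynomialEmbedding K V) :=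
  AddMonoidAlgebra.mapDomain_injective fun _ _ h => toInt_injective (congrArg Prod.fst h)

lemma doubleDegree_injective : Function.Injective (doubleDegree K V) :=
  AddMonoidAlgebra.mapDomain_injective
    (Function.injective_id.prodMap (mul_right_injective₀ two_ne_zero))

variable [Fintype V] {G : SimpleGraph V} {N : ℕ} (C : Fin N ≃ OddCycle G)

/-- The polynomial side records the total degree `2 * m` and the Ehrhart side records `m`. Doubling
the latter makes the images agree without any halving of exponents. -/
lemma image_monomials_eq (m : ℕ) :
    polynomialEmbedding K V '' ((fun a => monomial a 1) '' hyperedgeExponents C m) =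
      doubleDegree K V '' {f | ∃ a ∈ latticePoints (edgePolytope G) m,
        f = AddMonoidAlgebra.single (a, m) 1} := by
  ext f
  constructor
  · rintro ⟨_, ⟨a, ha, rfl⟩, rfl⟩
    refine ⟨_, ⟨toInt a, ?_, rfl⟩, ?_⟩
    · rw [← image_toInt_hyperedgeExponents C]
      exact ⟨a, ha, rfl⟩
    · simp only [polynomialEmbedding_monomial, doubleDegree_single, ha.2]
  · rintro ⟨_, ⟨z, hz, rfl⟩, rfl⟩
    rw [← image_toInt_hyperedgeExponents C] at hz
    obtain ⟨a, ha, rfl⟩ := hz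
    refine ⟨_, ⟨a, ha, rfl⟩, ?_⟩
    simp only [polynomialEmbedding_monomial, doubleDegree_single, ha.2]

lemma hyperedgeMonoid_eq_iUnion :
    (hyperedgeMonoid C : Set (V →₀ ℕ)) = ⋃ m, hyperedgeExponents C m := by
  ext a
  rw [Set.mem_iUnion]
  refine ⟨fun ha => ?_, fun ⟨m, hm⟩ => hm.1⟩
  obtain ⟨m, hm⟩ := even_degree_of_mem C ha
  exact ⟨m, ha, by rw [hm, two_mul]⟩

lemma map_hyperedgeRing_eq : (hyperedgeRing K C).map (polynomialEmbedding K V) =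
    (ehrhartRing K (edgePolytope G)).map (doubleDegree K V) := by
  have h : {f : AddMonoidAlgebra K ((V → ℤ) × ℕ) | ∃ (m : ℕ) (a : V → ℤ),
      a ∈ latticePoints (edgePolytope G) m ∧ f = AddMonoidAlgebra.single (a, m) 1} =
      ⋃ m, {f | ∃ a ∈ latticePoints (edgePolytope G) m,
        f = AddMonoidAlgebra.single (a, m) 1} := by
    ext f; simp
  rw [hyperedgeRing_eq_adjoin, ehrhartRing, AlgHom.map_adjoin, AlgHom.map_adjoin, h,
    hyperedgeMonoid_eq_iUnion, Set.image_iUnion, Set.image_iUnion, Set.image_iUnion]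
  simp only [image_monomials_eq]

lemma exists_algEquiv_ehrhartRing :
    ∃ φ : hyperedgeRing K C ≃ₐ[K] ehrhartRing K (edgePolytope G),
      ∀ m, (hyperedgePiece K C m).map φ.toLinearMap = ehrhartPiece K (edgePolytope G) m := by
  obtain ⟨φ, hφ⟩ := exists_algEquiv_of_map_eq (polynomialEmbedding_injective K)
    (doubleDegree_injective K) (map_hyperedgeRing_eq K C)
  refine ⟨φ, fun m => ?_⟩
  rw [hyperedgePiece_eq]
  refine map_comap_val_eq (polynomialEmbedding_injective K) (doubleDegree_injective K) φ hφ ?_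
  rw [monomialSpan, Submodule.map_span, Submodule.map_span]
  exact congrArg _ (image_monomials_eq K C m)

end Comparison

end HyperedgeRing

end

theorem proposition2p1 (K : Type*) [Field K] [CharZero K] {V : Type*} [Fintype V]
    (G : SimpleGraph V) (hG : G.Connected) {N : ℕ} (C : Fin N ≃ HyperedgeRing.OddCycle G) :
    -- the degrees of the generators
    (∀ e : G.edgeSet, HyperedgeRing.psiDegree K C (Finsupp.single (Sum.inl e) 1) = 1) ∧
    (∀ θ : HyperedgeRing.Theta C,
      HyperedgeRing.psiDegree K C (Finsupp.single (Sum.inr θ) 1) =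
        (((C θ.1.1).1.verts.ncard : ℚ) + ((C θ.1.2).1.verts.ncard : ℚ)) / 2) ∧
    -- the hyperedge ring is graded by this degree
    Nonempty (GradedAlgebra (HyperedgeRing.hyperedgePiece K C)) ∧
    -- its Hilbert series (all pieces being finite-dimensional) is the Ehrhart series
    (∀ m, FiniteDimensional K (HyperedgeRing.hyperedgePiece K C m)) ∧
    (∀ m, (HyperedgeRing.latticePoints (HyperedgeRing.edgePolytope G) m).Finite) ∧
    HyperedgeRing.hilbertSeries (HyperedgeRing.hyperedgePiece K C) =
      HyperedgeRing.ehrhartSeries (HyperedgeRing.edgePolytope G) ∧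
    -- it is the Ehrhart ring, as a graded algebra
    ∃ φ : HyperedgeRing.hyperedgeRing K C ≃ₐ[K]
        HyperedgeRing.ehrhartRing K (HyperedgeRing.edgePolytope G),
      ∀ m, (HyperedgeRing.hyperedgePiece K C m).map φ.toLinearMap =
        HyperedgeRing.ehrhartPiece K (HyperedgeRing.edgePolytope G) m := by
  refine ⟨fun e => ?_, fun θ => ?_, HyperedgeRing.nonempty_gradedAlgebra K C,
    HyperedgeRing.finiteDimensional_hyperedgePiece K C, fun m => ?_,
    HyperedgeRing.hilbertSeries_hyperedgePiece K C,
    HyperedgeRing.exists_algEquiv_ehrhartRing K C⟩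
  · rw [HyperedgeRing.psiDegree_eq, HyperedgeRing.expHom_single, one_smul,
      HyperedgeRing.degree_hyperedgeVec_edge]
    norm_num
  · rw [HyperedgeRing.psiDegree_eq, HyperedgeRing.expHom_single, one_smul]
    simp [HyperedgeRing.hyperedgeVec, HyperedgeRing.degree_setVec]
  · rw [← HyperedgeRing.image_toInt_hyperedgeExponents C]
    exact (HyperedgeRing.finite_hyperedgeExponents C m).image _
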